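/- Let $(M,\omega)$ be a complex symplectic manifold, i.e. a complex manifold with a closed, nondegenerate holomorphic $2$-form $\omega$, and let $\mathcal J$ denote the complex structure operator on $TM$. Let $c=\omega^{-1}\in\Gamma(\bigwedge^2T^{1,0}M)\subset\Gamma(\bigwedge^2T^{\mathbb C}M)$ be the holomorphic Poisson bivector inverse to $\omega$, put $c_1=\operatorname{Re}c$, $c_2=\operatorname{Im}c$, and let $J=\{\lambda_1c_1+\lambda_2c_2:\lambda_1,\lambda_2\in\mathbb R\}$ be the associated holomorphic symplectic bihamiltonian structure. Let $p:M\to M'$ be a $C^\infty$ surjective submersion onto a $C^\infty$ manifold $M'$ with connected fibres, and let $\mathcal K$ be the foliation of $M$ by the fibres of $p$, so that $T_x\mathcal K=\ker p_{*,x}$. Assume that: (a) $J$ is projectable via $p$: for $i=1,2$ the bivector $c_i$ admits the push-forward, i.e. $\bigwedge^2p_*(c_i(x))$ depends, locally on $M$, only on $p(x)$, so that $c_i'(p(x))=\bigwedge^2p_*(c_i(x))$ is a well-defined bivector field on $M'$; and $c_1',c_2'$ are either linearly independent over $\mathbb R$ or both zero. The reduction of $J$ is $J'=\operatorname{Span}_{\mathbb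 R}\{c_1',c_2'\}$. (b) $\mathcal K$ is completely real: $T_x\mathcal K\oplus\mathcal J\,T_x\mathcal K=T_xM$ for every $x\in M$. For a bivector $b$ at a point, $\operatorname{rank}b$ is the rank of the map $\alpha\mapsto b(\alpha,\cdot)$ from covectors to vectors. Put $R_0'=\max_{b\in J'}\max_{x'\in M'}\operatorname{rank}b(x')$ and $(J')^{\mathbb C}=\operatorname{Span}_{\mathbb C}\{c_1',c_2'\}$. The structure $J'$ is called complete at $x'\in M'$ if $\operatorname{rank}_{\mathbb C}b(x')=R_0'$ for every $b\in (J')^{\mathbb C}\setminus\{0\}$, and complete if it is complete at every point of some open dense subset of $M'$. Then: if $J'$ is nontrivial, i.e. $J'\neq\{0\}$, then $J'$ is not complete. -/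

import Mathlib

open Set Topology
open scoped Manifold ContDiff

noncomputable section

/-! ### Bivectors on a real vector space -/

/-- `𝕜`-valued covectors on a real vector space `V`: the dual `V*` for `𝕜 = ℝ`, and the dual
`(V^ℂ)*` of the complexification for `𝕜 = ℂ` (a complex functional on `V^ℂ` is determined by its
restriction to `V`, an arbitrary real-linear map `V → ℂ`). -/
abbrev Covector (𝕜 : Type*) [RCLike 𝕜] (V : Type*) [AddCommGroup V] [Module ℝ V] : Type _ :=
  V →ₗ[ℝ] 𝕜

/-- Bivectors on `V` with coefficients in `𝕜`: elements of `⋀² V` for `𝕜 = ℝ` and of `⋀² (V^ℂ)` for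
`𝕜 = ℂ`, seen (`V` being finite-dimensional) as alternating bilinear forms on covectors. As a map
into the bidual, such a form `c` is the sharp map `c♯ α = c(α, ·)`. -/
def Bivector (𝕜 : Type*) [RCLike 𝕜] (V : Type*) [AddCommGroup V] [Module ℝ V] :
    Submodule 𝕜 (Covector 𝕜 V →ₗ[𝕜] Covector 𝕜 V →ₗ[𝕜] 𝕜) where
  carrier := {c | c.IsAlt}
  add_mem' {a b} ha hb := fun α => by simp [ha.self_eq_zero α, hb.self_eq_zero α]
  zero_mem' := fun α => by simp
  smul_mem' t a ha := fun α => by simp [ha.self_eq_zero α]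

namespace Bivector

section

variable {𝕜 : Type*} [RCLike 𝕜] {V W : Type*} [AddCommGroup V] [Module ℝ V]
  [AddCommGroup W] [Module ℝ W]

/-- The rank of a bivector: the dimension over `𝕜` of the image of its sharp map. -/
def rank (c : Bivector 𝕜 V) : ℕ :=
  Module.finrank 𝕜 (LinearMap.range c.1)

/-- The transpose of a linear map `f : V → W` on covectors. -/
def transpose (𝕜 : Type*) [RCLike 𝕜] (f : V →ₗ[ℝ] W) : Covector 𝕜 W →ₗ[𝕜] Covector 𝕜 V where
  toFun α := α ∘ₗ f
  map_add' _ _ := rfl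
  map_smul' _ _ := rfl

/-- The map `⋀² f` on bivectors induced by a linear map `f`. -/
def map (f : V →ₗ[ℝ] W) (c : Bivector 𝕜 V) : Bivector 𝕜 W :=
  ⟨c.1.compl₁₂ (transpose 𝕜 f) (transpose 𝕜 f), fun α => c.2 (transpose 𝕜 f α)⟩

end

section Complex

variable {V : Type*} [AddCommGroup V] [Module ℝ V]

/-- A real covector seen as a complex one. -/
def covectorOfReal : Covector ℝ V →ₗ[ℝ] Covector ℂ V where
  toFun α := Complex.ofRealCLM.toLinearMap ∘ₗ α
  map_add' α β := by ext v; simp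
  map_smul' t α := by ext v; simp

/-- The real part of a complex covector. -/
def covectorRe : Covector ℂ V →ₗ[ℝ] Covector ℝ V where
  toFun α := Complex.reLm ∘ₗ α
  map_add' α β := by ext v; simp
  map_smul' t α := by ext v; simp

/-- The imaginary part of a complex covector. -/
def covectorIm : Covector ℂ V →ₗ[ℝ] Covector ℝ V where
  toFun α := Complex.imLm ∘ₗ α
  map_add' α β := by ext v; simp
  map_smul' t α := by ext v; simp

/-- The real part of a complex bivector. -/
def re (c : Bivector ℂ V) : Bivector ℝ V :=
  ⟨LinearMap.mk₂ ℝ (fun α β => (c.1 (covectorOfReal α) (covectorOfReal β)).re)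
    (by intros; simp) (by intros; simp) (by intros; simp) (by intros; simp),
   fun α => by simp [c.2.self_eq_zero]⟩

/-- The imaginary part of a complex bivector. -/
def im (c : Bivector ℂ V) : Bivector ℝ V :=
  ⟨LinearMap.mk₂ ℝ (fun α β => (c.1 (covectorOfReal α) (covectorOfReal β)).im)
    (by intros; simp) (by intros; simp) (by intros; simp) (by intros; simp),
   fun α => by simp [c.2.self_eq_zero]⟩

lemma covectorRe_smul (t : ℂ) (α : Covector ℂ V) :
    covectorRe (t • α) = t.re • covectorRe α - t.im • covectorIm α := by
  ext v; simp [covectorRe, covectorIm]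

lemma covectorIm_smul (t : ℂ) (α : Covector ℂ V) :
    covectorIm (t • α) = t.re • covectorIm α + t.im • covectorRe α := by
  ext v; simp [covectorRe, covectorIm]

/-- A real bivector seen as a complex one, by complex-bilinear extension. -/
def complexify (c : Bivector ℝ V) : Bivector ℂ V :=
  ⟨LinearMap.mk₂ ℂ (fun α β =>
      (⟨c.1 (covectorRe α) (covectorRe β) - c.1 (covectorIm α) (covectorIm β),
        c.1 (covectorRe α) (covectorIm β) + c.1 (covectorIm α) (covectorRe β)⟩ : ℂ))
    (by intros; apply Complex.ext <;> simp <;> ring)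
    (by intros; apply Complex.ext <;> simp [covectorRe_smul, covectorIm_smul] <;> ring)
    (by intros; apply Complex.ext <;> simp <;> ring)
    (by intros; apply Complex.ext <;> simp [covectorRe_smul, covectorIm_smul] <;> ring),
   fun α => by
    have h := c.2.neg (covectorRe α) (covectorIm α)
    apply Complex.ext <;> simp [c.2.self_eq_zero, ← h]⟩

end Complex

section Inverse

variable {V : Type*} [AddCommGroup V] [Module ℝ V] [Module ℂ V] [IsScalarTower ℝ ℂ V]

/-- The `(1,0)`-part `α^{1,0}(v) = (α(v) - i α(i v)) / 2` of a complex covector, a complex-linear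
functional on `V`. This is the restriction of `α` to `V^{1,0} = {v - i 𝒥 v}`, under the
complex-linear isomorphism `V ≅ V^{1,0}`, `v ↦ (v - i 𝒥 v) / 2`. -/
def covector10 : Covector ℂ V →ₗ[ℂ] Module.Dual ℂ V where
  toFun α :=
    { toFun := fun v => (α v - Complex.I * α (Complex.I • v)) / 2
      map_add' := fun v w => by simp only [smul_add, map_add]; ring
      map_smul' := fun t v => by
        have key : ∀ u : V, α (t • u) = t.re * α u + t.im * α (Complex.I • u) := by
          intro u
          have : t • u = t.re • u + t.im • (Complex.I • u) := by
            conv_lhs => rw [← Complex.re_add_im t]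
            rw [add_smul, mul_smul, ← algebraMap_smul ℂ t.re u,
              ← algebraMap_smul ℂ t.im (Complex.I • u)]
            rfl
          rw [this, map_add, map_smul, map_smul, Complex.real_smul, Complex.real_smul]
        have h2 : Complex.I • t • v = t • Complex.I • v := smul_comm _ _ _
        have h3 : Complex.I • Complex.I • v = -v := by
          rw [smul_smul, Complex.I_mul_I, neg_one_smul]
        rw [h2, key v, key (Complex.I • v), h3, map_neg, RingHom.id_apply, smul_eq_mul]
        conv_rhs => rw [← Complex.re_add_im t]
        linear_combination ((t.im : ℂ) * α (Complex.I • v) / 2) * Complex.I_sq }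
  map_add' α β := by ext v; simp; ring
  map_smul' t α := by ext v; simp; ring

variable [FiniteDimensional ℂ V]

/-- The isomorphism `V → V*`, `v ↦ w(v, ·)` given by a nondegenerate complex-bilinear form. -/
def flat (w : V →ₗ[ℂ] V →ₗ[ℂ] ℂ) (hw : LinearMap.ker w = ⊥) : V ≃ₗ[ℂ] Module.Dual ℂ V :=
  LinearMap.linearEquivOfInjective w (LinearMap.ker_eq_bot.1 hw) Subspace.dual_finrank_eq.symm

/-- The complex bivector of type `(2,0)` inverse to a nondegenerate alternating complex-bilinear
form `w` on `V ≅ V^{1,0}`: it depends only on the `(1,0)`-parts of its arguments, and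
`c(w(u, ·), w(v, ·)) = w(u, v)`. -/
def inverse (w : V →ₗ[ℂ] V →ₗ[ℂ] ℂ) (hw : LinearMap.ker w = ⊥) (halt : w.IsAlt) : Bivector ℂ V :=
  ⟨w.compl₁₂ ((flat w hw).symm.toLinearMap ∘ₗ covector10)
      ((flat w hw).symm.toLinearMap ∘ₗ covector10), fun _ => halt _⟩

end Inverse

end Bivector

/-- A continuous alternating `2`-form as a bilinear form. -/
def bilinOfForm {E : Type*} [TopologicalSpace E] [AddCommGroup E] [Module ℂ E]
    (w : E [⋀^Fin 2]→L[ℂ] ℂ) : E →ₗ[ℂ] E →ₗ[ℂ] ℂ :=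
  LinearMap.mk₂ ℂ (fun u v => w ![u, v])
    (fun _ _ _ => w.toAlternatingMap.map_vecCons_add _ _ _)
    (fun _ _ _ => w.toAlternatingMap.map_vecCons_smul _ _ _)
    (fun u v v' => by
      have h := w.toMultilinearMap.map_update_add ![u, 0] 1 v v'
      have e : ∀ a : E, Function.update ![u, 0] 1 a = ![u, a] := fun a => by
        ext i; fin_cases i <;> simp
      rwa [e, e, e] at h)
    (fun t u v => by
      have h := w.toMultilinearMap.map_update_smul ![u, 0] 1 t v
      have e : ∀ a : E, Function.update ![u, 0] 1 a = ![u, a] := fun a => by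
        ext i; fin_cases i <;> simp
      rwa [e, e] at h)

lemma bilinOfForm_isAlt {E : Type*} [TopologicalSpace E] [AddCommGroup E] [Module ℂ E]
    (w : E [⋀^Fin 2]→L[ℂ] ℂ) : (bilinOfForm w).IsAlt := fun u =>
  w.map_eq_zero_of_eq ![u, u] (i := 0) (j := 1) rfl (by decide)

/-! ### Bivector fields, bihamiltonian structures and completeness -/

section Fields

variable (𝕜 : Type*) [RCLike 𝕜] (E : Type*) [NormedAddCommGroup E] [NormedSpace ℝ E]
  (M : Type*) [TopologicalSpace M] [ChartedSpace E M]

/-- Real (`𝕜 = ℝ`) or complex (`𝕜 = ℂ`) bivector fields on a manifold `M` modelled on `E`. -/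
abbrev BivectorField : Type _ := ∀ x : M, Bivector 𝕜 (TangentSpace 𝓘(ℝ, E) x)

end Fields

section Complete

variable {E : Type*} [NormedAddCommGroup E] [NormedSpace ℝ E]
  {M : Type*} [TopologicalSpace M] [ChartedSpace E M]

/-- The real family `J` of bivector fields generated by a pair `c₁, c₂`. -/
def pencil (c₁ c₂ : BivectorField ℝ E M) : Submodule ℝ (BivectorField ℝ E M) :=
  Submodule.span ℝ {c₁, c₂}

/-- The complexification `J^ℂ` of a family `J` of real bivector fields. -/
def complexification (J : Submodule ℝ (BivectorField ℝ E M)) :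
    Submodule ℂ (BivectorField ℂ E M) :=
  Submodule.span ℂ {d | ∃ c ∈ J, d = fun x => Bivector.complexify (c x)}

/-- The maximal rank `R₀ = max_{c ∈ J} max_{x ∈ M} rank c(x)` of the bivectors of `J`. -/
def maxRank (J : Submodule ℝ (BivectorField ℝ E M)) : ℕ :=
  sSup {r : ℕ | ∃ c ∈ J, ∃ x : M, r = Bivector.rank (c x)}

/-- `J` is complete at `x`: every nonzero element of `J^ℂ` has rank `R₀` at `x`. -/
def IsCompleteStructureAt (J : Submodule ℝ (BivectorField ℝ E M)) (x : M) : Prop :=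
  ∀ d ∈ complexification J, d ≠ 0 → Bivector.rank (d x) = maxRank J

/-- `J` is complete: it is complete at every point of some open dense subset of `M`. -/
def IsCompleteStructure (J : Submodule ℝ (BivectorField ℝ E M)) : Prop :=
  ∃ U : Set M, IsOpen U ∧ Dense U ∧ ∀ x ∈ U, IsCompleteStructureAt J x

end Complete

/-! ### Reduction along the fibres of a submersion -/

section Reduction

variable {E : Type*} [NormedAddCommGroup E] [NormedSpace ℝ E]
  {M : Type*} [TopologicalSpace M] [ChartedSpace E M]
  {E' : Type*} [NormedAddCommGroup E'] [NormedSpace ℝ E']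
  {M' : Type*} [TopologicalSpace M'] [ChartedSpace E' M']

variable (E E') in
/-- `p` is a `C^∞` surjective submersion with connected fibres. The leaves of the foliation `𝒦`
on `M` defined by `p` are the fibres of `p`. -/
structure IsFibration (p : M → M') : Prop where
  smooth : ContMDiff 𝓘(ℝ, E) 𝓘(ℝ, E') ∞ p
  surjective : Function.Surjective p
  submersion : ∀ x : M, Function.Surjective (mfderiv 𝓘(ℝ, E) 𝓘(ℝ, E') p x)
  connected : ∀ x' : M', IsConnected (p ⁻¹' {x'})

variable (E E') in
/-- The tangent space `T_x 𝒦 = ker p_{*,x}` to the leaf through `x` of the foliation `𝒦`. -/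
def leafTangent (p : M → M') (x : M) : Submodule ℝ (TangentSpace 𝓘(ℝ, E) x) :=
  LinearMap.ker (mfderiv 𝓘(ℝ, E) 𝓘(ℝ, E') p x).toLinearMap

/-- The value `⋀² p_* (Z(x))`, a bivector at the point `p x` of `M'`. -/
def pushAt {𝕜 : Type*} [RCLike 𝕜] (p : M → M') (Z : BivectorField 𝕜 E M) (x : M) :
    Bivector 𝕜 (TangentSpace 𝓘(ℝ, E') (p x)) :=
  Bivector.map (mfderiv 𝓘(ℝ, E) 𝓘(ℝ, E') p x).toLinearMap (Z x)

variable (E') in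
/-- `Z` is projectable (admits the push-forward): locally on `M` it is of the form
`Z = Z'(y) + Z̃(x, y)` where `Z'` depends only on the coordinates `y` constant on the leaves, i.e.
comes from the base, and `Z̃` is killed by `⋀² p_*`. -/
def IsProjectable (p : M → M') (Z : BivectorField ℝ E M) : Prop :=
  ∀ x : M, ∃ U ∈ 𝓝 x, ∃ Z' : BivectorField ℝ E' M', ∀ y ∈ U, pushAt p Z y = Z' (p y)

/-- The push-forward `Z'(x') = ⋀² p_* (Z(x))`, where `x` is any point of the fibre over `x'`.
(The value is independent of `x` if `Z` is projectable and the fibres are connected.) -/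
def pushforward (p : M → M') (hp : Function.Surjective p) (Z : BivectorField ℝ E M) :
    BivectorField ℝ E' M' :=
  fun x' => Function.surjInv_eq hp x' ▸ pushAt p Z (Function.surjInv hp x')

variable (E') in
/-- The bihamiltonian structure generated by `c₁, c₂` is projectable via `p`: both bivector fields
are, and their push-forwards are linearly independent or both zero. -/
def IsProjectablePair (p : M → M') (hp : Function.Surjective p)
    (c₁ c₂ : BivectorField ℝ E M) : Prop :=
  IsProjectable E' p c₁ ∧ IsProjectable E' p c₂ ∧
    (LinearIndependent ℝ ![(pushforward p hp c₁ : BivectorField ℝ E' M'), pushforward p hp c₂] ∨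
      ((pushforward p hp c₁ : BivectorField ℝ E' M') = 0 ∧
        (pushforward p hp c₂ : BivectorField ℝ E' M') = 0))

/-- The reduction `J'` of the structure `J` generated by `c₁, c₂`: the family of bivector fields
on `M'` generated by the push-forwards of `c₁, c₂`. -/
def reduction (p : M → M') (hp : Function.Surjective p) (c₁ c₂ : BivectorField ℝ E M) :
    Submodule ℝ (BivectorField ℝ E' M') :=
  pencil (pushforward p hp c₁) (pushforward p hp c₂)

end Reduction

/-! ### Complex symplectic manifolds -/

section Symplectic

variable {E : Type*} [NormedAddCommGroup E] [NormedSpace ℂ E]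
  {M : Type*} [TopologicalSpace M] [ChartedSpace E M]

/-- The coordinate expression of a `(2,0)`-form on `M` in the preferred chart at `x₀`: its
pull-back under the inverse of the chart. -/
def formInChart (Ω : ∀ x : M, TangentSpace 𝓘(ℂ, E) x [⋀^Fin 2]→L[ℂ] ℂ) (x₀ : M) (y : E) :
    E [⋀^Fin 2]→L[ℂ] ℂ :=
  (Ω ((chartAt E x₀).symm y)).compContinuousLinearMap
    (mfderiv 𝓘(ℂ, E) 𝓘(ℂ, E) (chartAt E x₀).symm y)

/-- `Ω` is a holomorphic symplectic form: holomorphic, closed and nondegenerate. -/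
structure IsHolomorphicSymplectic
    (Ω : ∀ x : M, TangentSpace 𝓘(ℂ, E) x [⋀^Fin 2]→L[ℂ] ℂ) : Prop where
  holomorphic : ∀ x₀ : M, DifferentiableOn ℂ (formInChart Ω x₀) (chartAt E x₀).target
  closed : ∀ x₀ : M, ∀ y ∈ (chartAt E x₀).target, extDeriv (formInChart Ω x₀) y = 0
  nondegenerate : ∀ x : M, LinearMap.ker (bilinOfForm (Ω x)) = ⊥

/-- The holomorphic bivector field `c = Ω⁻¹`. -/
def inverseField [FiniteDimensional ℂ E]
    (Ω : ∀ x : M, TangentSpace 𝓘(ℂ, E) x [⋀^Fin 2]→L[ℂ] ℂ)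
    (hΩ : IsHolomorphicSymplectic Ω) : BivectorField ℂ E M :=
  fun x => Bivector.inverse (V := E) (bilinOfForm (Ω x)) (hΩ.nondegenerate x)
    (bilinOfForm_isAlt (Ω x))

/-- `c₁ = Re Ω⁻¹`, the first of the two generators of the holomorphic symplectic bihamiltonian
structure `J` of `(M, Ω)`. -/
def reInverseField [FiniteDimensional ℂ E]
    (Ω : ∀ x : M, TangentSpace 𝓘(ℂ, E) x [⋀^Fin 2]→L[ℂ] ℂ)
    (hΩ : IsHolomorphicSymplectic Ω) : BivectorField ℝ E M :=
  fun x => Bivector.re (inverseField Ω hΩ x)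

/-- `c₂ = Im Ω⁻¹`, the second generator. -/
def imInverseField [FiniteDimensional ℂ E]
    (Ω : ∀ x : M, TangentSpace 𝓘(ℂ, E) x [⋀^Fin 2]→L[ℂ] ℂ)
    (hΩ : IsHolomorphicSymplectic Ω) : BivectorField ℝ E M :=
  fun x => Bivector.im (inverseField Ω hΩ x)

/-- The complex structure `𝒥` of the tangent space `T_x M`: multiplication by `i`. -/
def complexStructure (x : M) : TangentSpace 𝓘(ℝ, E) x →ₗ[ℝ] TangentSpace 𝓘(ℝ, E) x :=
  (LinearMap.lsmul ℂ E Complex.I).restrictScalars ℝ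

variable {E' : Type*} [NormedAddCommGroup E'] [NormedSpace ℝ E']
  {M' : Type*} [TopologicalSpace M'] [ChartedSpace E' M']

variable (E E') in
/-- The foliation `𝒦` by the fibres of `p` is completely real:
`T_x 𝒦 ⊕ 𝒥 T_x 𝒦 = T_x M` for every `x`. -/
def IsCompletelyReal (p : M → M') : Prop :=
  ∀ x : M, IsCompl (leafTangent E E' p x) ((leafTangent E E' p x).map (complexStructure x))

end Symplectic

end

/-! The obstruction is pointwise: `J'` is complete at no point at all. Fix `x' = p x` and write `c =
c₁ + i c₂` for the `(2,0)`-bivector inverse to the symplectic form. Since `ker p_*` is completely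
real, `p_*` restricts to an isomorphism of `T^{1,0}_x M` onto the complexified tangent space at `x'`
(`covector10_transpose_bijective`, in dual form). It therefore carries the nondegenerate `c` to a
nondegenerate bivector (`map_inverse_injective`), and this image is `c₁' + i c₂'`, an element of the
complexified pencil.

Over `ℂ`, however, a pencil containing an isomorphism of nonzero spaces also contains a nontrivial
degenerate combination (`exists_degenerate_combination`). When `c₁', c₂'` are independent over `ℝ`,
both combinations are nonzero fields (`combination_ne_zero`). They have different ranks at `x'`, so
these ranks cannot both be `R₀'`. -/

namespace Bivector

/-! ### Linear algebra of complex pencils and complexified bivectors -/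

section LinearAlgebra

/-- A pencil of linear maps `W → W'` over an algebraically closed field which contains an
isomorphism also contains a degenerate nonzero combination. -/
lemma exists_degenerate_combination {W W' : Type*} [AddCommGroup W] [Module ℂ W]
    [FiniteDimensional ℂ W] [Nontrivial W] [AddCommGroup W'] [Module ℂ W']
    [FiniteDimensional ℂ W']
    (hdim : Module.finrank ℂ W = Module.finrank ℂ W') (A B : W →ₗ[ℂ] W')
    (h : Function.Injective (A + Complex.I • B)) :
    ∃ a b : ℂ, (a ≠ 0 ∨ b ≠ 0) ∧ ∃ u : W, u ≠ 0 ∧ (a • A + b • B) u = 0 := by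
  let e := LinearMap.linearEquivOfInjective (A + Complex.I • B) h hdim
  -- An eigenvector `u` of `(A + iB)⁻¹ A` satisfies `A u = t (A u + i B u)`, so `(1 - t) A - t i B`
  -- kills it. The two coefficients never vanish together.
  obtain ⟨t, ht⟩ := Module.End.exists_eigenvalue (e.symm.toLinearMap ∘ₗ A)
  obtain ⟨u, hu⟩ := ht.exists_hasEigenvector
  have h1 : A u = t • (A u + Complex.I • B u) := by
    have h2 := congrArg e hu.apply_eq_smul
    simpa [e] using h2
  refine ⟨1 - t, -(t * Complex.I), ?_, u, hu.2, ?_⟩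
  · by_cases ht0 : t = 0
    · left; simp [ht0]
    · right; simp [ht0]
  · rw [smul_add, smul_smul] at h1
    rw [LinearMap.add_apply, LinearMap.smul_apply, LinearMap.smul_apply, sub_smul, one_smul,
      neg_smul, ← sub_eq_add_neg, sub_sub, sub_eq_zero]
    exact h1

variable {V : Type*} [AddCommGroup V] [Module ℝ V]

lemma complexify_re_add_im (c : Bivector ℂ V) (α β : Covector ℂ V) :
    (complexify (re c)).1 α β + Complex.I * (complexify (im c)).1 α β = c.1 α β := by
  have dec : ∀ γ : Covector ℂ V,
      γ = covectorOfReal (covectorRe γ) + Complex.I • covectorOfReal (covectorIm γ) := by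
    intro γ
    ext v
    apply Complex.ext <;> simp [covectorOfReal, covectorRe, covectorIm]
  conv_rhs => rw [dec α, dec β]
  simp only [map_add, map_smul, LinearMap.add_apply, LinearMap.smul_apply, smul_eq_mul]
  apply Complex.ext <;> simp [complexify, re, im] <;> ring

/-- Pushing forward by a real map commutes with taking real and imaginary parts, so `c₁' + i c₂'`
can be studied as the image of `c` itself. -/
lemma complexify_map_re_add_im {W : Type*} [AddCommGroup W] [Module ℝ W] (f : V →ₗ[ℝ] W)
    (c : Bivector ℂ V) :
    (complexify (map f (re c))).1 + Complex.I • (complexify (map f (im c))).1 = (map f c).1 :=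
  LinearMap.ext fun α => LinearMap.ext fun β =>
    complexify_re_add_im c (transpose ℂ f α) (transpose ℂ f β)

lemma complexify_ofReal (c : Bivector ℝ V) (α β : Covector ℝ V) :
    (complexify c).1 (covectorOfReal α) (covectorOfReal β) = (c.1 α β : ℂ) := by
  have hr : ∀ γ : Covector ℝ V, covectorRe (covectorOfReal γ) = γ := fun γ => by
    ext v; simp [covectorOfReal, covectorRe]
  have hi : ∀ γ : Covector ℝ V, covectorIm (covectorOfReal γ) = 0 := fun γ => by
    ext v; simp [covectorOfReal, covectorIm]
  apply Complex.ext <;> simp [complexify, hr, hi]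

/-- Complexified real bivectors satisfy a complex linear relation only if they satisfy its real
and imaginary parts. -/
lemma real_relations_of_complexify {a b : ℂ} {c₁ c₂ : Bivector ℝ V}
    (h : a • complexify c₁ + b • complexify c₂ = 0) :
    a.re • c₁ + b.re • c₂ = 0 ∧ a.im • c₁ + b.im • c₂ = 0 := by
  have key : ∀ α β : Covector ℝ V, a * (c₁.1 α β : ℂ) + b * (c₂.1 α β : ℂ) = 0 := fun α β => by
    have := congrArg
      (fun d : Bivector ℂ V => d.1 (covectorOfReal α) (covectorOfReal β)) h
    simpa [complexify_ofReal] using this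
  constructor <;> apply Subtype.ext <;> apply LinearMap.ext <;> intro α <;>
    apply LinearMap.ext <;> intro β
  · simpa using congrArg Complex.re (key α β)
  · simpa using congrArg Complex.im (key α β)

lemma rank_eq_finrank_of_injective {c : Bivector ℂ V} (h : Function.Injective c.1) :
    rank c = Module.finrank ℂ (Covector ℂ V) :=
  LinearMap.finrank_range_of_inj h

lemma rank_lt_finrank [FiniteDimensional ℝ V] {c : Bivector ℂ V} {u : Covector ℂ V}
    (hu : u ≠ 0) (h : c.1 u = 0) : rank c < Module.finrank ℂ (Covector ℂ V) := by
  have h1 := LinearMap.finrank_range_add_finrank_ker c.1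
  have h2 : 0 < Module.finrank ℂ (LinearMap.ker c.1) :=
    Module.finrank_pos_iff_exists_ne_zero.2 ⟨⟨u, h⟩, fun h0 => hu (congrArg Subtype.val h0)⟩
  unfold rank
  omega

end LinearAlgebra

/-! ### Bivectors of type (2,0) pushed forward along a completely real kernel -/

section CompletelyReal

variable {V : Type*} [AddCommGroup V] [Module ℝ V] [Module ℂ V] [IsScalarTower ℝ ℂ V]
  {W : Type*} [AddCommGroup W] [Module ℝ W]

/-- If `ker f` is completely real, then `f` induces an isomorphism of `V^{1,0}` onto the
complexification of its image; here in dual form. -/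
lemma covector10_transpose_bijective (f : V →ₗ[ℝ] W) (hf : Function.Surjective f)
    (hK : IsCompl (LinearMap.ker f)
      ((LinearMap.ker f).map ((LinearMap.lsmul ℂ V Complex.I).restrictScalars ℝ))) :
    Function.Bijective
      ((covector10 (V := V)).comp (transpose ℂ f) : Covector ℂ W →ₗ[ℂ] Module.Dual ℂ V) := by
  have hdec : ∀ v : V, ∃ k ∈ LinearMap.ker f, ∃ k' ∈ LinearMap.ker f,
      v = k + Complex.I • k' := by
    intro v
    have hv : v ∈ LinearMap.ker f ⊔
        (LinearMap.ker f).map ((LinearMap.lsmul ℂ V Complex.I).restrictScalars ℝ) := by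
      rw [hK.sup_eq_top]; trivial
    obtain ⟨k, hk, l, ⟨k', hk', rfl⟩, rfl⟩ := Submodule.mem_sup.1 hv
    exact ⟨k, hk, k', hk', rfl⟩
  have hII : ∀ v : V, Complex.I • Complex.I • v = -v := fun v => by
    rw [smul_smul, Complex.I_mul_I, neg_one_smul]
  constructor
  -- Every vector of `W` is `f (i k')` with `k' ∈ ker f`. Evaluating the `(1,0)`-part at `k'` leaves
  -- only a multiple of `α (f (i k'))`.
  · rw [injective_iff_map_eq_zero]
    intro α hα
    ext w
    obtain ⟨v, rfl⟩ := hf w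
    obtain ⟨k, hk, k', hk', rfl⟩ := hdec v
    have h1 := LinearMap.congr_fun hα k'
    rw [LinearMap.mem_ker] at hk hk'
    simpa [covector10, transpose, hk, hk'] using h1
  · intro φ
    -- The preimage of `φ` is `2φ` composed with the projection onto `i ker f` along `ker f`. It
    -- vanishes on `ker f`, so it descends to `W`; the factor 2 cancels the 1/2 in the `(1,0)`-part.
    let P := Submodule.projectionOnto _ _ hK.symm
    let β : Covector ℂ V := (2 • φ).restrictScalars ℝ ∘ₗ Submodule.subtype _ ∘ₗ P
    obtain ⟨g, hg⟩ := f.exists_rightInverse_of_surjective (LinearMap.range_eq_top.2 hf)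
    have hβ0 : ∀ k ∈ LinearMap.ker f, β k = 0 := by
      intro k hk
      simp [β, P, Submodule.projectionOnto_apply_of_mem_right hK.symm hk]
    have hβ1 : ∀ k ∈ LinearMap.ker f, β (Complex.I • k) = 2 * φ (Complex.I • k) := by
      intro k hk
      have h1 := Submodule.projectionOnto_apply_left hK.symm ⟨Complex.I • k, k, hk, rfl⟩
      change (2 • φ) (P (Complex.I • k) : V) = _
      rw [show P (Complex.I • k) = _ from h1]
      simp [mul_left_comm]
    have hβ : transpose ℂ f (β ∘ₗ g) = β := by
      ext v
      have : g (f v) - v ∈ LinearMap.ker f := by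
        rw [LinearMap.mem_ker, map_sub, sub_eq_zero]
        exact LinearMap.congr_fun hg (f v)
      have := hβ0 _ this
      rw [map_sub, sub_eq_zero] at this
      exact this
    refine ⟨β ∘ₗ g, ?_⟩
    rw [LinearMap.comp_apply, hβ]
    ext v
    obtain ⟨k, hk, k', hk', rfl⟩ := hdec v
    have e : covector10 β (k + Complex.I • k') = (β (k + Complex.I • k')
      - Complex.I * β (Complex.I • (k + Complex.I • k'))) / 2 := rfl
    rw [e, smul_add, hII, map_add, map_add, map_neg, hβ0 k hk, hβ0 k' hk', hβ1 k hk, hβ1 k' hk',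
      map_add, map_smul, map_smul]
    simp only [smul_eq_mul]
    linear_combination (-φ k) * Complex.I_sq

/-- The pushed-forward bivector is `w` with both arguments transported along the same bijection from
complex covectors on `W` to `V`, so it inherits nondegeneracy. -/
lemma map_inverse_injective [FiniteDimensional ℂ V] (w : V →ₗ[ℂ] V →ₗ[ℂ] ℂ)
    (hw : LinearMap.ker w = ⊥) (halt : w.IsAlt) (f : V →ₗ[ℝ] W) (hf : Function.Surjective f)
    (hK : IsCompl (LinearMap.ker f)
      ((LinearMap.ker f).map ((LinearMap.lsmul ℂ V Complex.I).restrictScalars ℝ))) :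
    Function.Injective (map f (inverse w hw halt)).1 := by
  obtain ⟨hinj, hsurj⟩ := covector10_transpose_bijective f hf hK
  rw [injective_iff_map_eq_zero]
  intro α hα
  apply hinj
  rw [map_zero]
  apply (flat w hw).symm.injective
  rw [map_zero]
  apply LinearMap.ker_eq_bot.1 hw
  rw [map_zero]
  ext v
  -- Surjectivity makes an arbitrary `v` available as the second argument of `w`.
  obtain ⟨β, hβ⟩ := hsurj (flat w hw v)
  have h1 : w ((flat w hw).symm (((covector10 (V := V)).comp (transpose ℂ f)) α))
      ((flat w hw).symm (((covector10 (V := V)).comp (transpose ℂ f)) β)) = 0 :=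
    LinearMap.congr_fun hα β
  rw [hβ, LinearEquiv.symm_apply_apply] at h1
  exact h1

end CompletelyReal

end Bivector

/-! ### Incompleteness of a pencil with a nondegenerate complex member -/

section Completeness

variable {E' : Type*} [NormedAddCommGroup E'] [NormedSpace ℝ E']
  {M' : Type*} [TopologicalSpace M'] [ChartedSpace E' M']

lemma combination_mem_complexification (c₁ c₂ : BivectorField ℝ E' M') (a b : ℂ) :
    a • (fun x => Bivector.complexify (c₁ x) : BivectorField ℂ E' M') +
      b • (fun x => Bivector.complexify (c₂ x) : BivectorField ℂ E' M') ∈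
        complexification (pencil c₁ c₂) :=
  add_mem
    (Submodule.smul_mem _ _ (Submodule.subset_span
      ⟨c₁, Submodule.subset_span (Set.mem_insert _ _), rfl⟩))
    (Submodule.smul_mem _ _ (Submodule.subset_span
      ⟨c₂, Submodule.subset_span (Set.mem_insert_of_mem _ rfl), rfl⟩))

/-- A complex relation with constant coefficients splits into two real ones, so independence over
`ℝ` gives independence over `ℂ`. Nonvanishing is as a field, which is what completeness asks for;
the value at a given point may be zero. -/
lemma combination_ne_zero {c₁ c₂ : BivectorField ℝ E' M'}
    (hli : LinearIndependent ℝ ![c₁, c₂]) {a b : ℂ} (hab : a ≠ 0 ∨ b ≠ 0) :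
    a • (fun x => Bivector.complexify (c₁ x) : BivectorField ℂ E' M') +
      b • (fun x => Bivector.complexify (c₂ x) : BivectorField ℂ E' M') ≠ 0 := by
  intro h
  have hpair : ∀ s t : ℝ, s • c₁ + t • c₂ = 0 → s = 0 ∧ t = 0 := fun s t hst => by
    have hzero := Fintype.linearIndependent_iffₛ.1 hli ![s, t] 0
      (by simpa [Fin.sum_univ_two] using hst)
    exact ⟨hzero 0, hzero 1⟩
  have hx : ∀ x, a.re • c₁ x + b.re • c₂ x = 0 ∧ a.im • c₁ x + b.im • c₂ x = 0 := fun x => by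
    have hx : a • Bivector.complexify (c₁ x) + b • Bivector.complexify (c₂ x) = 0 := congrFun h x
    exact Bivector.real_relations_of_complexify hx
  obtain ⟨hre₁, hre₂⟩ :=
    hpair a.re b.re (funext fun x => (hx x).1)
  obtain ⟨him₁, him₂⟩ :=
    hpair a.im b.im (funext fun x => (hx x).2)
  exact hab.elim (fun h => h (Complex.ext hre₁ him₁)) (fun h => h (Complex.ext hre₂ him₂))

/-- A two-dimensional pencil whose complexification contains a bivector nondegenerate at `x` is
not complete at `x`. -/
lemma not_isCompleteStructureAt_pencil [FiniteDimensional ℝ E'] {c₁ c₂ : BivectorField ℝ E' M'}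
    (hli : LinearIndependent ℝ ![c₁, c₂]) {x : M'}
    (hx : Function.Injective ((Bivector.complexify (c₁ x)).1 + Complex.I • (Bivector.complexify (c₂ x)).1)) :
    ¬ IsCompleteStructureAt (pencil c₁ c₂) x := by
  intro hc
  -- An eigenvector needs a nonzero space. Without nonzero covectors every bivector field vanishes,
  -- against independence.
  have hW : Nontrivial (Covector ℂ E') := by
    by_contra hn
    rw [not_nontrivial_iff_subsingleton] at hn
    refine combination_ne_zero hli (a := 1) (b := 0) (Or.inl one_ne_zero) ?_
    funext y
    apply Subtype.ext
    apply LinearMap.ext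
    intro α
    have : α = 0 := hn.elim (α : Covector ℂ E') 0
    rw [this, map_zero, map_zero]
  have : FiniteDimensional ℝ (TangentSpace 𝓘(ℝ, E') x) := ‹FiniteDimensional ℝ E'›
  have : Nontrivial (Covector ℂ (TangentSpace 𝓘(ℝ, E') x)) := hW
  obtain ⟨a, b, hab, u, hu, hu0⟩ := Bivector.exists_degenerate_combination
    Subspace.dual_finrank_eq.symm _ _ hx
  -- Completeness equates both ranks with `maxRank`, whose value is never needed: the nondegenerate
  -- and the degenerate member are compared directly.
  have r₁ := hc _ (combination_mem_complexification c₁ c₂ 1 Complex.I)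
    (combination_ne_zero hli (Or.inl one_ne_zero))
  have r₂ := hc _ (combination_mem_complexification c₁ c₂ a b) (combination_ne_zero hli hab)
  have s₁ := Bivector.rank_eq_finrank_of_injective
    (c := (1 : ℂ) • (Bivector.complexify (c₁ x)) + Complex.I • (Bivector.complexify (c₂ x)))
    (by simpa using hx)
  have s₂ := Bivector.rank_lt_finrank
    (c := a • (Bivector.complexify (c₁ x)) + b • (Bivector.complexify (c₂ x))) hu hu0
  exact absurd ((r₂.trans r₁.symm).trans s₁) s₂.ne

end Completeness

/-! ### Nondegeneracy of the reduced bivector and the theorem -/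

lemma pushforward_complexify_injective
    {E : Type*} [NormedAddCommGroup E] [NormedSpace ℂ E] [FiniteDimensional ℂ E]
    {M : Type*} [TopologicalSpace M] [ChartedSpace E M]
    {E' : Type*} [NormedAddCommGroup E'] [NormedSpace ℝ E']
    {M' : Type*} [TopologicalSpace M'] [ChartedSpace E' M']
    (Ω : ∀ x : M, TangentSpace 𝓘(ℂ, E) x [⋀^Fin 2]→L[ℂ] ℂ)
    (hΩ : IsHolomorphicSymplectic Ω) (p : M → M') (hp : IsFibration E E' p)
    (hreal : IsCompletelyReal E E' p) (x' : M') :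
    Function.Injective
      ((Bivector.complexify
          (pushforward (E' := E') p hp.surjective (reInverseField Ω hΩ) x')).1 +
        Complex.I • (Bivector.complexify
          (pushforward (E' := E') p hp.surjective (imInverseField Ω hΩ) x')).1) := by
  -- The pushforward is transported along `p x = x'` for a chosen preimage `x`. Making `x` and `x'`
  -- variables lets the equality be eliminated.
  have key : ∀ (x : M) (x' : M') (h : p x = x'), Function.Injective
      ((Bivector.complexify (h ▸ pushAt p (reInverseField Ω hΩ) x :
          Bivector ℝ (TangentSpace 𝓘(ℝ, E') x'))).1 +
        Complex.I • (Bivector.complexify (h ▸ pushAt p (imInverseField Ω hΩ) x :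
          Bivector ℝ (TangentSpace 𝓘(ℝ, E') x'))).1) := by
    rintro x _ rfl
    let w : E →ₗ[ℂ] E →ₗ[ℂ] ℂ := bilinOfForm (Ω x)
    let f : E →ₗ[ℝ] E' := (mfderiv 𝓘(ℝ, E) 𝓘(ℝ, E') p x).toLinearMap
    have hinj := Bivector.map_inverse_injective w (hΩ.nondegenerate x) (bilinOfForm_isAlt (Ω x))
      f (hp.submersion x) (hreal x)
    have hmap : (Bivector.complexify (Bivector.map f (Bivector.re
          (Bivector.inverse w (hΩ.nondegenerate x) (bilinOfForm_isAlt (Ω x)))))).1 +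
        Complex.I • (Bivector.complexify (Bivector.map f (Bivector.im
          (Bivector.inverse w (hΩ.nondegenerate x) (bilinOfForm_isAlt (Ω x)))))).1 =
        (Bivector.map f
          (Bivector.inverse w (hΩ.nondegenerate x) (bilinOfForm_isAlt (Ω x)))).1 :=
      Bivector.complexify_map_re_add_im f _
    rw [← hmap] at hinj
    exact hinj
  exact key _ x' (Function.surjInv_eq hp.surjective x')

theorem mainTheorem12
    {E : Type*} [NormedAddCommGroup E] [NormedSpace ℂ E] [FiniteDimensional ℂ E]
    {M : Type*} [TopologicalSpace M] [ChartedSpace E M] [IsManifold 𝓘(ℂ, E) ω M]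
    {E' : Type*} [NormedAddCommGroup E'] [NormedSpace ℝ E'] [FiniteDimensional ℝ E']
    {M' : Type*} [TopologicalSpace M'] [ChartedSpace E' M'] [IsManifold 𝓘(ℝ, E') ∞ M']
    (Ω : ∀ x : M, TangentSpace 𝓘(ℂ, E) x [⋀^Fin 2]→L[ℂ] ℂ)
    (hΩ : IsHolomorphicSymplectic Ω)
    (p : M → M') (hp : IsFibration E E' p)
    (hproj : IsProjectablePair E' p hp.surjective (reInverseField Ω hΩ) (imInverseField Ω hΩ))
    (hreal : IsCompletelyReal E E' p)
    (hnontrivial : (reduction p hp.surjective (reInverseField Ω hΩ) (imInverseField Ω hΩ) :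
      Submodule ℝ (BivectorField ℝ E' M')) ≠ ⊥) :
    ¬ IsCompleteStructure (reduction p hp.surjective (reInverseField Ω hΩ) (imInverseField Ω hΩ) :
      Submodule ℝ (BivectorField ℝ E' M')) := by
  rintro ⟨U, -, hU, hc⟩
  rcases hproj.2.2 with hli | ⟨h₁, h₂⟩
  -- On an empty `M'` all fields coincide, which independence forbids; a dense set then has a point
  -- to test.
  · have : Nonempty M' := by
      by_contra hM
      rw [not_nonempty_iff] at hM
      exact hli.ne_zero 0 (Subsingleton.elim _ _)
    obtain ⟨x', hx'⟩ := hU.nonempty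
    exact not_isCompleteStructureAt_pencil hli
      (pushforward_complexify_injective Ω hΩ p hp hreal x') (hc x' hx')
  · apply hnontrivial
    rw [reduction, pencil, h₁, h₂]
    simp
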